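/- Let $K$ be a field, let $m,k\ge 0$, let $A=K[a_1,\dots,a_m]$, and let $P=A[x_1,\dots,x_k]$ be graded by giving the elements of $A$ degree $0$ and each $x_j$ a degree $w_j$, where $w_1,\dots,w_k$ are positive integers. Let $I\subseteq P$ be a homogeneous ideal with $I\cap A=\{0\}$, and let $R=P/I$ (a positive $A$-algebra). Let $\Theta:\operatorname{Spec}(R)\to\operatorname{Spec}(A)=\mathbb{A}^m_K$ be the morphism induced by $A\to R$. Let $\Gamma=(\gamma_1,\dots,\gamma_m)\in K^m$. Let $R_{\Gamma_0}$ be the localization of $R$ at the maximal ideal $\mathfrak{M}_{\Gamma_0}/I$, where $\mathfrak{M}_{\Gamma_0}\subseteq P$ is the maximal ideal of the point $\Gamma_0=(\gamma_1,\dots,\gamma_m,0,\dots,0)\in K^{m+k}$, and let $d_{\Gamma_0}$ be its Krull dimension. Let $F_\Gamma=\Theta^{-1}(\Gamma)$ be the scheme-theoretic fiber, a scheme over $K$. Let $I_\Gamma\subseteq K[x_1,\dots,x_k]$ be the ideal generated by the polynomials obtained from the elements of $I$ by substituting $a_i\mapsto\gamma_i$, so that $K[x_1,\dots,x_k]/I_\Gamma$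 is the coordinate ring of $F_\Gamma$. Let $R_{F_\Gamma}$ be the localization of $K[x_1,\dots,x_k]/I_\Gamma$ at $\langle x_1,\dots,x_k\rangle/I_\Gamma$, and let $d_{F_\Gamma}$ be its Krull dimension. Then the following conditions are equivalent: (a) The local ring $R_{\Gamma_0}$ is regular. (b) The local ring $R_{F_\Gamma}$ is regular, and $d_{F_\Gamma}=d_{\Gamma_0}-m$. In addition, if $R_{F_\Gamma}$ is a regular local ring, then the fiber $F_\Gamma$ is isomorphic, as a scheme over $K$, to an affine space $\mathbb{A}^d_K$ for some $d\ge 0$. -/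

import Mathlib

open AlgebraicGeometry CategoryTheory

universe u

/-- The trivially graded polynomial ring `A = K[a₁, …, aₘ]`. -/
abbrev BaseRing (K : Type u) [Field K] (m : ℕ) : Type u := MvPolynomial (Fin m) K

/-- The polynomial ring `P = A[x₁, …, xₖ]` over `A = K[a₁, …, aₘ]`. -/
abbrev TotalRing (K : Type u) [Field K] (m k : ℕ) : Type u :=
  MvPolynomial (Fin k) (BaseRing K m)

section

attribute [local instance] MvPolynomial.weightedGradedAlgebra

/-- The data defining a positive `A`-algebra `R = P / I`: positive integer weights
`w₁, …, wₖ` of the indeterminates `x₁, …, xₖ` (the elements of `A` having degree zero)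
and an ideal `I` of `P = A[x₁, …, xₖ]` which is homogeneous for the resulting grading and
satisfies `I ∩ A = {0}`. -/
structure PositiveAlgebra (K : Type u) [Field K] (m k : ℕ) where
  weight : Fin k → ℤ
  weight_pos : ∀ j, 0 < weight j
  ideal : Ideal (TotalRing K m k)
  isHomogeneous :
    ideal.IsHomogeneous (MvPolynomial.weightedHomogeneousSubmodule (BaseRing K m) weight)
  comap_C_eq_bot : ideal.comap (MvPolynomial.C : BaseRing K m →+* TotalRing K m k) = ⊥

end

namespace PositiveAlgebra

variable {K : Type u} [Field K] {m k : ℕ} (R : PositiveAlgebra K m k) (Γ : Fin m → K)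

/-- The ring `R = P / I`. -/
def ring : Type u := TotalRing K m k ⧸ R.ideal

noncomputable instance : CommRing R.ring := Ideal.Quotient.commRing R.ideal

/-- The residue class homomorphism `P → R = P / I`. -/
noncomputable def proj : TotalRing K m k →+* R.ring := Ideal.Quotient.mk R.ideal

/-- Evaluation of the elements of `P` at the zero point `Γ₀ = (γ₁, …, γₘ, 0, …, 0)`. -/
noncomputable def evalZeroPoint (k : ℕ) (Γ : Fin m → K) : TotalRing K m k →+* K :=
  MvPolynomial.eval₂Hom (MvPolynomial.eval Γ) (fun _ => 0)

/-- The maximal ideal `𝔐` of `P` corresponding to the zero point `Γ₀` over `Γ`. -/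
noncomputable def zeroPointIdeal (k : ℕ) (Γ : Fin m → K) : Ideal (TotalRing K m k) :=
  RingHom.ker (evalZeroPoint k Γ)

/-- The maximal ideal `𝔐 / I` of `R = P / I`. -/
noncomputable def zeroPointIdealQuot : Ideal R.ring :=
  (zeroPointIdeal k Γ).map R.proj

/-- The fiber ideal: the ideal of `K[x₁, …, xₖ]` generated by the polynomials obtained from
the elements of `I` by substituting `aᵢ ↦ γᵢ`. -/
noncomputable def fiberIdeal : Ideal (MvPolynomial (Fin k) K) :=
  R.ideal.map (MvPolynomial.map (MvPolynomial.eval Γ))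

/-- The coordinate ring `K[x₁, …, xₖ] / I_Γ` of the fiber over `Γ`. -/
abbrev fiberRing : Type u := MvPolynomial (Fin k) K ⧸ R.fiberIdeal Γ

/-- The ideal `⟨x₁, …, xₖ⟩ / I_Γ` of the origin in the coordinate ring of the fiber. -/
noncomputable def fiberOriginIdeal : Ideal (R.fiberRing Γ) :=
  (Ideal.span (Set.range (MvPolynomial.X : Fin k → MvPolynomial (Fin k) K))).map
    (Ideal.Quotient.mk (R.fiberIdeal Γ))

/-! The facts needed to form the two local rings. -/

lemma constantCoeff_eq_zero {f : TotalRing K m k} (hf : f ∈ R.ideal) :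
    MvPolynomial.constantCoeff f = 0 := by
  have h0 := MvPolynomial.weightedHomogeneousComponent_mem_of_mem _ _ R.isHomogeneous hf 0
  have h1 : MvPolynomial.weightedHomogeneousComponent R.weight 0 f
      = MvPolynomial.C (MvPolynomial.constantCoeff f) := by
    classical
    ext d : 1
    rw [MvPolynomial.coeff_weightedHomogeneousComponent, MvPolynomial.coeff_C]
    have hd : Finsupp.weight R.weight d = 0 ↔ 0 = d := by
      constructor
      · intro h
        rw [Finsupp.weight_apply, Finsupp.sum_fintype _ _ (by simp)] at h
        rw [Finset.sum_eq_zero_iff_of_nonneg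
          (fun j _ => nsmul_nonneg (R.weight_pos j).le _)] at h
        ext j
        have := h j (Finset.mem_univ j)
        have hw := R.weight_pos j
        simp only [nsmul_eq_mul, mul_eq_zero] at this
        have : (d j : ℤ) = 0 := this.resolve_right hw.ne'
        have h3 : d j = 0 := by exact_mod_cast this
        simp [h3]
      · rintro rfl
        simp
    by_cases h : 0 = d
    · rw [if_pos (hd.2 h), if_pos h, ← h]
      rfl
    · rw [if_neg (fun h' => h (hd.1 h')), if_neg h]
  rw [h1] at h0
  have h2 : MvPolynomial.constantCoeff f ∈
      R.ideal.comap (MvPolynomial.C : BaseRing K m →+* TotalRing K m k) := h0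
  rwa [R.comap_C_eq_bot] at h2

lemma ideal_le_zeroPointIdeal : R.ideal ≤ zeroPointIdeal k Γ := by
  intro f hf
  have h : evalZeroPoint k Γ
      = (MvPolynomial.eval Γ).comp
        (MvPolynomial.constantCoeff : TotalRing K m k →+* BaseRing K m) := by
    apply MvPolynomial.ringHom_ext <;> intros <;> simp [evalZeroPoint]
  rw [zeroPointIdeal, RingHom.mem_ker, h, RingHom.comp_apply, R.constantCoeff_eq_zero hf,
    map_zero]

lemma fiberIdeal_le : R.fiberIdeal Γ ≤
    Ideal.span (Set.range (MvPolynomial.X : Fin k → MvPolynomial (Fin k) K)) := by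
  rw [fiberIdeal, Ideal.map_le_iff_le_comap]
  intro f hf
  rw [Ideal.mem_comap, ← Set.image_univ, MvPolynomial.mem_ideal_span_X_image]
  intro d hd
  by_contra hcon
  have hd0 : d = 0 := by
    ext j
    by_contra hj
    exact hcon ⟨j, Set.mem_univ j, hj⟩
  have hc : MvPolynomial.coeff 0 f = 0 := R.constantCoeff_eq_zero hf
  rw [MvPolynomial.mem_support_iff, hd0, MvPolynomial.coeff_map, hc, map_zero] at hd
  exact hd rfl

lemma isPrime_span_range_X : (Ideal.span
    (Set.range (MvPolynomial.X : Fin k → MvPolynomial (Fin k) K))).IsPrime := by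
  have h : Ideal.span (Set.range (MvPolynomial.X : Fin k → MvPolynomial (Fin k) K))
      = RingHom.ker (MvPolynomial.constantCoeff : MvPolynomial (Fin k) K →+* K) := by
    apply le_antisymm
    · rw [Ideal.span_le]
      rintro _ ⟨j, rfl⟩
      simp
    · intro f hf
      rw [← Set.image_univ, MvPolynomial.mem_ideal_span_X_image]
      intro d hd
      by_contra hcon
      have hd0 : d = 0 := by
        ext j
        by_contra hj
        exact hcon ⟨j, Set.mem_univ j, hj⟩
      rw [hd0, MvPolynomial.mem_support_iff] at hd
      exact hd hf
  rw [h]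
  exact RingHom.ker_isPrime _

instance isPrime_zeroPointIdealQuot : (R.zeroPointIdealQuot Γ).IsPrime := by
  have : (zeroPointIdeal k Γ).IsPrime := RingHom.ker_isPrime _
  have hs : Function.Surjective R.proj := Ideal.Quotient.mk_surjective
  apply Ideal.map_isPrime_of_surjective hs
  have hk : RingHom.ker R.proj = R.ideal := Ideal.mk_ker
  rw [hk]
  exact R.ideal_le_zeroPointIdeal Γ

instance isPrime_fiberOriginIdeal : (R.fiberOriginIdeal Γ).IsPrime := by
  have := isPrime_span_range_X (K := K) (k := k)
  apply Ideal.map_isPrime_of_surjective Ideal.Quotient.mk_surjective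
  rw [Ideal.mk_ker]
  exact R.fiberIdeal_le Γ

/-- The local ring `R_{Γ₀}` of `R` at the zero point over `Γ`. -/
abbrev localRingZeroPoint : Type u := Localization.AtPrime (R.zeroPointIdealQuot Γ)

/-- The local ring `R_{F_Γ}` of the fiber over `Γ` at its origin. -/
abbrev localRingFiber : Type u := Localization.AtPrime (R.fiberOriginIdeal Γ)

/-- The canonical morphism `Θ : Spec R ⟶ Spec A = 𝔸ᵐ`, induced by `A → P → R`. -/
noncomputable def canonicalMorphism :
    Spec (CommRingCat.of R.ring) ⟶ Spec (CommRingCat.of (BaseRing K m)) :=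
  Spec.map (CommRingCat.ofHom (R.proj.comp MvPolynomial.C))

/-- The `K`-rational point of `Spec A` with coordinates `Γ`. -/
noncomputable def basePoint (Γ : Fin m → K) : Spec (CommRingCat.of (BaseRing K m)) :=
  (⟨RingHom.ker (MvPolynomial.eval Γ : BaseRing K m →+* K), RingHom.ker_isPrime _⟩ :
    PrimeSpectrum (BaseRing K m))

/-- The fiber `F_Γ` of the canonical morphism over `Γ` (the scheme-theoretic fiber, with
its embedding into `Spec R`), as a scheme over `Spec K`. -/
noncomputable def fiber : Over (Spec (CommRingCat.of K)) :=
  Over.mk (R.canonicalMorphism.fiberι (basePoint Γ) ≫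
    Spec.map (CommRingCat.ofHom (R.proj.comp (MvPolynomial.C.comp MvPolynomial.C))))

/-- Affine space `𝔸ᵈ = Spec K[y₁, …, y_d]` as a scheme over `Spec K`. -/
noncomputable def affineSpaceOver (K : Type u) [Field K] (d : ℕ) :
    Over (Spec (CommRingCat.of K)) :=
  Over.mk (Spec.map (CommRingCat.ofHom (algebraMap K (MvPolynomial (Fin d) K))))

end PositiveAlgebra

/-! A Noetherian local ring is regular when its embedding dimension equals its Krull dimension, so
both invariants are compared at `Γ₀` and at the origin of the fiber. At a rational point the
embedding dimension is the number of coordinates minus the rank of the linear parts of the relations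
(`finrank_cotangentSpace_add_finrank_map`). Positive weights and `I ∩ A = 0` force each element of
`I` to have constant coefficient zero in `A`. Its linear part at `Γ₀` therefore involves only the
`xⱼ` and is that of its specialization in `I_Γ`; hence edim `R_{Γ₀}` = edim `R_{F_Γ}` + m
(`finrank_cotangentSpace_localRingZeroPoint`).

The fiber is cut out by the m equations `aᵢ = γᵢ`, so dim `R_{Γ₀}` ≤ dim `R_{F_Γ}` + m ≤ edim
`R_{F_Γ}` + m = edim `R_{Γ₀}`. The two ends agree exactly when both inequalities are equalities,
which is the equivalence.

For the last claim, choose a minimal set of generators of the fiber ring among the `xⱼ`. By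
homogeneity the relations between them have no linear part, so the embedding dimension is their
number n. Regularity gives dimension at least n, and a nonzero relation would make it smaller than n
(`exists_algEquiv_of_isRegularLocalRing`). A pushout square identifies the scheme-theoretic fiber
with the spectrum of the fiber ring. -/

/-! ### Embedding dimension at a rational point -/

open IsLocalRing in
/-- The embedding dimension of a local ring of a quotient of `P` at a rational point, in terms of
the linear parts at this point of the relations. -/
theorem finrank_cotangentSpace_add_finrank_map {K P S σ : Type*} [Field K] [CommRing P]
    [Algebra K P] [CommRing S] [Fintype σ] [DecidableEq σ] (ε : P →ₐ[K] K) (X : σ → P)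
    (hX : Ideal.span (Set.range X) = RingHom.ker ε) (l : P →ₗ[K] (σ → K))
    (hl : ∀ s t, l (X s) t = if s = t then 1 else 0)
    (hmul : ∀ f ∈ RingHom.ker ε, ∀ g ∈ RingHom.ker ε, l (f * g) = 0)
    (π : P →+* S) (hπ : Function.Surjective π) (hker : RingHom.ker π ≤ RingHom.ker ε)
    (p : Ideal S) [p.IsPrime] (hp : p = (RingHom.ker ε).map π) :
    Module.finrank (ResidueField (Localization.AtPrime p))
        (CotangentSpace (Localization.AtPrime p)) +
      Module.finrank K (((RingHom.ker π).restrictScalars K).map l) = Fintype.card σ := by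
  let Q := Localization.AtPrime p
  let φ : P →+* Q := (algebraMap S Q).comp π
  let : Algebra K Q := (φ.comp (algebraMap K P)).toAlgebra
  have hφK (c : K) : φ (algebraMap K P c) = algebraMap K Q c := rfl
  set M := RingHom.ker ε with hM
  have hl2 : ∀ f ∈ M ^ 2, l f = 0 := fun f hf => by
    rw [pow_two] at hf
    exact Submodule.mul_induction_on hf hmul fun f g hf hg => by rw [map_add, hf, hg, add_zero]
  have hmax : maximalIdeal Q = M.map φ := by
    rw [← Localization.AtPrime.map_eq_maximalIdeal, ← Ideal.map_map, ← hp]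
  have hcM (f : P) : f - algebraMap K P (ε f) ∈ M := by
    simp [hM, RingHom.mem_ker]
  have hφM {f : P} (hf : f ∈ M) : φ f ∈ maximalIdeal Q := hmax ▸ Ideal.mem_map_of_mem φ hf
  have hmem (f : P) : π f ∈ p ↔ f ∈ M := by
    refine ⟨fun h => ?_, fun h => hp ▸ Ideal.mem_map_of_mem π h⟩
    rw [hp, Ideal.mem_map_iff_of_surjective π hπ] at h
    obtain ⟨g, hg, hgf⟩ := h
    have : g - f ∈ M := hker (by simp [RingHom.mem_ker, hgf])
    simpa using M.sub_mem hg this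
  -- every element of `Q` is a scalar modulo the maximal ideal
  have hres (q : Q) : ∃ c : K, q - algebraMap K Q c ∈ maximalIdeal Q := by
    obtain ⟨⟨a, b⟩, rfl⟩ := IsLocalization.mk'_surjective p.primeCompl q
    obtain ⟨f, rfl⟩ := hπ a
    obtain ⟨b, hb⟩ := b
    obtain ⟨g, rfl⟩ := hπ b
    have hg : ε g ≠ 0 := fun h => hb ((hmem g).2 h)
    have hgu : IsUnit (φ g) := IsLocalization.map_units Q (⟨π g, hb⟩ : p.primeCompl)
    refine ⟨ε f / ε g, ?_⟩
    rw [← Ideal.unit_mul_mem_iff_mem _ hgu, mul_sub]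
    have h1 : φ g * IsLocalization.mk' Q (π f) (⟨π g, hb⟩ : p.primeCompl) = φ f := by
      rw [mul_comm]
      exact IsLocalization.mk'_spec Q (π f) (⟨π g, hb⟩ : p.primeCompl)
    rw [h1, ← hφK, ← map_mul, ← map_sub]
    apply hφM
    simp [hM, RingHom.mem_ker, mul_div_cancel₀ _ hg]
  have hsq {f : P} (hf : φ f ∈ maximalIdeal Q ^ 2) : ∃ u, ε u ≠ 0 ∧ ∃ g ∈ M ^ 2, ∃ h ∈
      RingHom.ker π, u * f = g + h := by
    have h1 : maximalIdeal Q ^ 2 = (p ^ 2).map (algebraMap S Q) := by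
      rw [Ideal.map_pow, Localization.AtPrime.map_eq_maximalIdeal]
    rw [h1] at hf
    obtain ⟨s, hs, hsf⟩ := (IsLocalization.algebraMap_mem_map_algebraMap_iff p.primeCompl _ _ _).1 hf
    obtain ⟨u, rfl⟩ := hπ s
    have hsf : π (u * f) ∈ p ^ 2 := by rwa [map_mul]
    rw [hp, ← Ideal.map_pow, Ideal.mem_map_iff_of_surjective π hπ] at hsf
    obtain ⟨g, hg, hgf⟩ := hsf
    exact ⟨u, fun h => hs ((hmem u).2 h), g, hg, u * f - g, by simp [RingHom.mem_ker, hgf],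
      by ring⟩
  -- First-order Taylor expansion: replacing the coefficients of `f` by their values at the point
  -- changes `f` by an element of `M ^ 2`, and `l` reads off these values.
  have hlin {f : P} (hf : f ∈ M) : f - ∑ s, l f s • X s ∈ M ^ 2 := by
    have hf' := hf
    rw [← hX, Ideal.mem_span_range_iff_exists_fun] at hf'
    obtain ⟨c, rfl⟩ := hf'
    have h1 : ∑ s, c s * X s - ∑ s, ε (c s) • X s ∈ M ^ 2 := by
      rw [← Finset.sum_sub_distrib]
      refine Ideal.sum_mem _ fun s _ => ?_
      rw [Algebra.smul_def, ← sub_mul, pow_two]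
      exact Ideal.mul_mem_mul (hcM _) (hX ▸ Ideal.subset_span ⟨s, rfl⟩)
    have h2 := hl2 _ h1
    rw [map_sub, sub_eq_zero] at h2
    have h3 (t : σ) : l (∑ s, c s * X s) t = ε (c t) := by
      rw [h2]
      simp [hl]
    simpa only [h3] using h1
  have hXm (s : σ) : φ (X s) ∈ maximalIdeal Q := hφM (hX ▸ Ideal.subset_span ⟨s, rfl⟩)
  -- The formula is rank-nullity for this map, which is onto and whose kernel is the space of linear
  -- parts of relations.
  let Φ : (σ → K) →ₗ[K] CotangentSpace Q :=
    Fintype.linearCombination K fun s => (maximalIdeal Q).toCotangent ⟨φ (X s), hXm s⟩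
  have hΦ (v : σ → K) : ∃ h, Φ v = (maximalIdeal Q).toCotangent ⟨φ (∑ s, v s • X s), h⟩ := by
    refine ⟨hφM (Ideal.sum_mem _ fun s _ => ?_), ?_⟩
    · rw [Algebra.smul_def]
      exact Ideal.mul_mem_left _ _ (hX ▸ Ideal.subset_span ⟨s, rfl⟩)
    · have : (⟨φ (∑ s, v s • X s), hφM (Ideal.sum_mem _ fun s _ => by
          rw [Algebra.smul_def]
          exact Ideal.mul_mem_left _ _ (hX ▸ Ideal.subset_span ⟨s, rfl⟩))⟩ : maximalIdeal Q)
          = ∑ s, algebraMap K Q (v s) • ⟨φ (X s), hXm s⟩ := by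
        ext
        simp [Algebra.smul_def, hφK]
      rw [this, map_sum]
      simp only [map_smul]
      rw [Fintype.linearCombination_apply]
      simp only [algebraMap_smul]
  have hkerΦ : LinearMap.ker Φ = ((RingHom.ker π).restrictScalars K).map l := by
    ext v
    obtain ⟨h, hv⟩ := hΦ v
    rw [LinearMap.mem_ker, hv, Ideal.toCotangent_eq_zero]
    have hlv : l (∑ s, v s • X s) = v := by
      ext t
      simp [hl]
    constructor
    · intro h2
      obtain ⟨u, hu, g, hg, f, hf, he⟩ := hsq h2
      -- Modulo `M ^ 2` the factor `u` acts as the scalar `ε u`, so the relation `f` has linear part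
      -- `ε u • v`.
      have h3 : (u - algebraMap K P (ε u)) * ∑ s, v s • X s ∈ M ^ 2 := by
        rw [pow_two]
        refine Ideal.mul_mem_mul (hcM u) (Ideal.sum_mem _ fun s _ => ?_)
        rw [Algebra.smul_def]
        exact Ideal.mul_mem_left _ _ (hX ▸ Ideal.subset_span ⟨s, rfl⟩)
      have h4 := hl2 _ h3
      rw [sub_mul, he, ← Algebra.smul_def, map_sub, map_add, hl2 g hg, map_smul, hlv, zero_add,
        sub_eq_zero] at h4
      refine ⟨(ε u)⁻¹ • f, ?_, ?_⟩
      · exact Submodule.smul_mem ((RingHom.ker π).restrictScalars K) _ hf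
      · rw [map_smul, h4, smul_smul, inv_mul_cancel₀ hu, one_smul]
    · rintro ⟨f, hf, rfl⟩
      have hf' : π f = 0 := hf
      have h2 := Ideal.mem_map_of_mem φ (hlin (hker hf))
      rw [Ideal.map_pow, ← hmax, map_sub] at h2
      have h0 : φ f = 0 := by simp [φ, hf']
      rw [h0, zero_sub, neg_mem_iff] at h2
      exact h2
  have hsurj : Function.Surjective Φ := by
    have htop : ∀ x : maximalIdeal Q, (maximalIdeal Q).toCotangent x ∈ LinearMap.range Φ := by
      rintro ⟨x, hx⟩
      rw [hmax, ← hX, Ideal.map_span, ← Set.range_comp] at hx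
      rw [Ideal.mem_span_range_iff_exists_fun] at hx
      obtain ⟨c, rfl⟩ := hx
      choose d hd using fun s => hres (c s)
      refine ⟨d, ?_⟩
      obtain ⟨h, hv⟩ := hΦ d
      rw [hv, Ideal.toCotangent_eq]
      simp only [map_sum, Function.comp_apply]
      rw [← Finset.sum_sub_distrib]
      refine Ideal.sum_mem _ fun s _ => ?_
      rw [Algebra.smul_def, map_mul, hφK, ← sub_mul, pow_two]
      refine Ideal.mul_mem_mul ?_ (hXm s)
      rw [← neg_sub]
      exact neg_mem (hd s)
    intro y
    obtain ⟨x, rfl⟩ := Ideal.toCotangent_surjective _ y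
    exact htop x
  -- The point is rational, so dimensions over `K` and over the residue field agree.
  have hfin : Module.finrank K (ResidueField Q) = 1 := by
    refine finrank_eq_one_iff_of_nonzero' (1 : ResidueField Q) one_ne_zero |>.2 fun w => ?_
    obtain ⟨q, rfl⟩ := residue_surjective w
    obtain ⟨c, hc⟩ := hres q
    refine ⟨c, ?_⟩
    rw [← residue_eq_zero_iff, map_sub, sub_eq_zero] at hc
    rw [hc, Algebra.smul_def, mul_one]
    rfl
  have htower : IsScalarTower K (ResidueField Q) (CotangentSpace Q) := by
    refine IsScalarTower.of_algebraMap_smul fun r x => ?_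
    rw [IsScalarTower.algebraMap_apply K Q (ResidueField Q), algebraMap_smul, algebraMap_smul]
  have h1 := Module.finrank_mul_finrank K (ResidueField Q) (CotangentSpace Q)
  rw [hfin, one_mul] at h1
  have h2 := Φ.finrank_range_add_finrank_ker
  rw [LinearMap.range_eq_top.2 hsurj, finrank_top, hkerΦ, Module.finrank_fintype_fun_eq_card] at h2
  rw [h1]
  exact h2

/-! ### Linear parts at the origin of a polynomial ring -/

namespace MvPolynomial

theorem coeff_single_one_mul {σ A : Type*} [CommRing A] (f g : MvPolynomial σ A) (s : σ) :
    coeff (Finsupp.single s 1) (f * g) =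
      coeff 0 f * coeff (Finsupp.single s 1) g + coeff (Finsupp.single s 1) f * coeff 0 g := by
  classical
  rw [coeff_mul, Finsupp.antidiagonal_single, Finset.sum_map]
  simp [Finset.Nat.antidiagonal_succ]

/-- The coefficients of the linear part of a polynomial. -/
noncomputable def linearPart (K σ : Type*) [Field K] : MvPolynomial σ K →ₗ[K] (σ → K) :=
  LinearMap.pi fun s => lcoeff K (Finsupp.single s 1)

theorem linearPart_apply {K σ : Type*} [Field K] (f : MvPolynomial σ K) (s : σ) :
    linearPart K σ f s = coeff (Finsupp.single s 1) f := rfl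

/-- Evaluation at the origin, as a homomorphism of algebras. -/
noncomputable abbrev evalOrigin (K σ : Type*) [Field K] : MvPolynomial σ K →ₐ[K] K :=
  aeval fun _ => 0

theorem evalOrigin_apply {K σ : Type*} [Field K] (f : MvPolynomial σ K) :
    evalOrigin K σ f = coeff 0 f := by
  rw [evalOrigin, ← constantCoeff_eq]
  exact aeval_zero' f

theorem ker_evalOrigin {K σ : Type*} [Field K] :
    Ideal.span (Set.range (X : σ → MvPolynomial σ K)) = RingHom.ker (evalOrigin K σ) := by
  apply le_antisymm
  · rw [Ideal.span_le]
    rintro _ ⟨j, rfl⟩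
    simp
  · intro f hf
    rw [RingHom.mem_ker, evalOrigin_apply] at hf
    rw [← Set.image_univ, mem_ideal_span_X_image]
    intro d hd
    by_contra hcon
    have hd0 : d = 0 := by
      ext j
      by_contra hj
      exact hcon ⟨j, Set.mem_univ j, hj⟩
    rw [hd0, mem_support_iff] at hd
    exact hd hf

theorem finrank_cotangentSpace_add_finrank_map_linearPart {K σ S : Type*} [Field K] [Fintype σ]
    [CommRing S] (π : MvPolynomial σ K →+* S) (hπ : Function.Surjective π)
    (hker : RingHom.ker π ≤ Ideal.span (Set.range X)) (p : Ideal S) [p.IsPrime]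
    (hp : p = (Ideal.span (Set.range X)).map π) :
    Module.finrank (IsLocalRing.ResidueField (Localization.AtPrime p))
        (IsLocalRing.CotangentSpace (Localization.AtPrime p)) +
      Module.finrank K (((RingHom.ker π).restrictScalars K).map (linearPart K σ)) =
        Fintype.card σ := by
  classical
  rw [ker_evalOrigin] at hp hker
  refine finrank_cotangentSpace_add_finrank_map (evalOrigin K σ) X ker_evalOrigin
    (linearPart K σ) ?_ ?_ π hπ hker p hp
  · intro s t
    rw [linearPart_apply, coeff_X]
    simp [Finsupp.single_left_inj]
  · intro f hf g hg
    rw [RingHom.mem_ker, evalOrigin_apply] at hf hg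
    ext s
    rw [linearPart_apply, coeff_single_one_mul, hf, hg]
    simp

end MvPolynomial

/-! ### The fiber ring as a quotient of `R`, and the dimension inequality -/

namespace PositiveAlgebra

open MvPolynomial

variable {K : Type u} [Field K] {m k : ℕ} (R : PositiveAlgebra K m k) (Γ : Fin m → K)

instance : IsNoetherianRing R.ring := inferInstanceAs (IsNoetherianRing (_ ⧸ R.ideal))

theorem proj_surjective : Function.Surjective R.proj := Ideal.Quotient.mk_surjective

theorem ker_proj : RingHom.ker R.proj = R.ideal := Ideal.mk_ker

/-- The restriction homomorphism `R → K[x₁, …, xₖ] / I_Γ`. -/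
noncomputable def toFiberRing : R.ring →+* R.fiberRing Γ :=
  Ideal.quotientMap (R.fiberIdeal Γ) (MvPolynomial.map (MvPolynomial.eval Γ)) Ideal.le_comap_map

theorem toFiberRing_proj (f : TotalRing K m k) :
    R.toFiberRing Γ (R.proj f) =
      Ideal.Quotient.mk (R.fiberIdeal Γ) (MvPolynomial.map (MvPolynomial.eval Γ) f) := rfl

theorem eval_surjective : Function.Surjective (MvPolynomial.eval Γ) :=
  fun c => ⟨C c, eval_C c⟩

theorem toFiberRing_surjective : Function.Surjective (R.toFiberRing Γ) := by
  intro y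
  obtain ⟨g, rfl⟩ := Ideal.Quotient.mk_surjective y
  obtain ⟨f, rfl⟩ := MvPolynomial.map_surjective _ (eval_surjective Γ) g
  exact ⟨R.proj f, rfl⟩

theorem mem_fiberIdeal_iff (g : MvPolynomial (Fin k) K) :
    g ∈ R.fiberIdeal Γ ↔ ∃ f ∈ R.ideal, MvPolynomial.map (MvPolynomial.eval Γ) f = g :=
  Ideal.mem_map_iff_of_surjective _ (MvPolynomial.map_surjective _ (eval_surjective Γ))

theorem sub_C_eval_mem_span (f : BaseRing K m) :
    f - C (MvPolynomial.eval Γ f) ∈ Ideal.span (Set.range fun i => X i - C (Γ i)) := by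
  induction f using MvPolynomial.induction_on with
  | C a => simp
  | add p q hp hq =>
    rw [map_add, map_add, add_sub_add_comm]
    exact add_mem hp hq
  | mul_X p i hp =>
    have : p * X i - C (MvPolynomial.eval Γ (p * X i)) =
        X i * (p - C (MvPolynomial.eval Γ p)) + C (MvPolynomial.eval Γ p) * (X i - C (Γ i)) := by
      simp only [map_mul, eval_X]
      ring
    rw [this]
    exact add_mem (Ideal.mul_mem_left _ _ hp)
      (Ideal.mul_mem_left _ _ (Ideal.subset_span ⟨i, rfl⟩))

theorem ker_eval : RingHom.ker (MvPolynomial.eval Γ) =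
    Ideal.span (Set.range fun i => X i - C (Γ i)) := by
  apply le_antisymm
  · intro f hf
    have := sub_C_eval_mem_span Γ f
    rwa [RingHom.mem_ker.1 hf, C_0, sub_zero] at this
  · rw [Ideal.span_le]
    rintro _ ⟨i, rfl⟩
    simp [RingHom.mem_ker]

/-- Every element of `I_Γ` lifts to `I`, so modulo `I` only the kernel of the substitution `aᵢ ↦ γᵢ`
is killed. -/
theorem ker_toFiberRing : RingHom.ker (R.toFiberRing Γ) =
    Ideal.span (Set.range fun i => R.proj (C (X i - C (Γ i)))) := by
  have h1 : Ideal.span (Set.range fun i => R.proj (C (X i - C (Γ i)))) =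
      (RingHom.ker (MvPolynomial.map (σ := Fin k) (MvPolynomial.eval Γ))).map R.proj := by
    rw [MvPolynomial.ker_map, ker_eval, Ideal.map_map, Ideal.map_span, ← Set.range_comp]
    rfl
  rw [h1]
  ext y
  obtain ⟨f, rfl⟩ := R.proj_surjective y
  rw [RingHom.mem_ker, toFiberRing_proj, Ideal.Quotient.eq_zero_iff_mem, mem_fiberIdeal_iff,
    Ideal.mem_map_iff_of_surjective _ R.proj_surjective]
  constructor
  · rintro ⟨g, hg, hgf⟩
    refine ⟨f - g, by simp [RingHom.mem_ker, hgf], ?_⟩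
    rw [map_sub, show R.proj g = 0 from Ideal.Quotient.eq_zero_iff_mem.2 hg, sub_zero]
  · rintro ⟨g, hg, hgf⟩
    refine ⟨f - g, ?_, by rw [map_sub, RingHom.mem_ker.1 hg, sub_zero]⟩
    rw [← R.ker_proj, RingHom.mem_ker, map_sub, hgf, sub_self]

theorem zeroPointIdeal_eq_span : Ideal.span (Set.range
    (Sum.elim (fun i => C (X i - C (Γ i))) X : Fin m ⊕ Fin k → TotalRing K m k)) =
      zeroPointIdeal k Γ := by
  apply le_antisymm
  · rw [Ideal.span_le]
    rintro _ ⟨i | j, rfl⟩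
    · simp [zeroPointIdeal, RingHom.mem_ker, evalZeroPoint]
    · simp [zeroPointIdeal, RingHom.mem_ker, evalZeroPoint]
  · set J := Ideal.span (Set.range
      (Sum.elim (fun i => C (X i - C (Γ i))) X : Fin m ⊕ Fin k → TotalRing K m k)) with hJ
    have key (f : TotalRing K m k) : f - C (C (evalZeroPoint k Γ f)) ∈ J := by
      induction f using MvPolynomial.induction_on with
      | C a =>
        have h1 : C (a - C (MvPolynomial.eval Γ a)) ∈ J := by
          have := Ideal.mem_map_of_mem (C : BaseRing K m →+* TotalRing K m k)
            (sub_C_eval_mem_span Γ a)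
          rw [Ideal.map_span] at this
          refine Ideal.span_mono ?_ this
          rintro _ ⟨_, ⟨i, rfl⟩, rfl⟩
          exact ⟨Sum.inl i, rfl⟩
        simpa [evalZeroPoint] using h1
      | add p q hp hq =>
        rw [map_add, map_add, map_add, add_sub_add_comm]
        exact add_mem hp hq
      | mul_X p j hp =>
        have : evalZeroPoint k Γ (p * X j) = 0 := by simp [evalZeroPoint]
        rw [this, map_zero, map_zero, sub_zero]
        exact Ideal.mul_mem_left _ _ (Ideal.subset_span ⟨Sum.inr j, rfl⟩)
    intro f hf
    have := key f
    rwa [RingHom.mem_ker.1 hf, map_zero, map_zero, sub_zero] at this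

theorem zeroPointIdeal_le_comap : zeroPointIdeal k Γ ≤ (Ideal.span (Set.range
    (X : Fin k → MvPolynomial (Fin k) K))).comap (MvPolynomial.map (MvPolynomial.eval Γ)) := by
  rw [← zeroPointIdeal_eq_span, Ideal.span_le]
  rintro _ ⟨i | j, rfl⟩
  · simp
  · simpa using! Ideal.subset_span (Set.mem_range_self j)

theorem map_toFiberRing : (R.zeroPointIdealQuot Γ).map (R.toFiberRing Γ) =
    R.fiberOriginIdeal Γ := by
  have h : (R.toFiberRing Γ).comp R.proj =
      (Ideal.Quotient.mk (R.fiberIdeal Γ)).comp (MvPolynomial.map (MvPolynomial.eval Γ)) := rfl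
  rw [zeroPointIdealQuot, Ideal.map_map, h, ← Ideal.map_map, fiberOriginIdeal]
  congr 1
  apply le_antisymm
  · rw [Ideal.map_le_iff_le_comap]
    exact zeroPointIdeal_le_comap Γ
  · rw [Ideal.span_le]
    rintro _ ⟨j, rfl⟩
    have : (X j : TotalRing K m k) ∈ zeroPointIdeal k Γ := by
      rw [← zeroPointIdeal_eq_span]
      exact Ideal.subset_span ⟨Sum.inr j, rfl⟩
    simpa using Ideal.mem_map_of_mem (MvPolynomial.map (MvPolynomial.eval Γ)) this

/-- Generalized Krull height theorem: factoring out m elements of a prime lowers its height by at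
most m. -/
theorem ringKrullDim_localRingZeroPoint_le :
    ringKrullDim (R.localRingZeroPoint Γ) ≤
      ringKrullDim (R.localRingFiber Γ) + (m : WithBot ℕ∞) := by
  rw [IsLocalization.AtPrime.ringKrullDim_eq_height (R.zeroPointIdealQuot Γ)
      (R.localRingZeroPoint Γ),
    IsLocalization.AtPrime.ringKrullDim_eq_height (R.fiberOriginIdeal Γ)
      (R.localRingFiber Γ)]
  set s := Set.range fun i => R.proj (C (X i - C (Γ i))) with hs
  have hsub : s ⊆ R.zeroPointIdealQuot Γ := by
    rintro _ ⟨i, rfl⟩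
    apply Ideal.mem_map_of_mem
    rw [← zeroPointIdeal_eq_span]
    exact Ideal.subset_span ⟨Sum.inl i, rfl⟩
  have h1 := Ideal.height_le_height_add_encard_of_subset s hsub
  let e : (R.ring ⧸ Ideal.span s) ≃+* R.fiberRing Γ :=
    (Ideal.quotEquivOfEq (R.ker_toFiberRing Γ).symm).trans
      (RingHom.quotientKerEquivOfSurjective (R.toFiberRing_surjective Γ))
  have h2 : ((R.zeroPointIdealQuot Γ).map (Ideal.Quotient.mk (Ideal.span s))).height =
      (R.fiberOriginIdeal Γ).height := by
    rw [← RingEquiv.height_map e, ← map_toFiberRing]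
    congr 1
    exact Ideal.map_map _ (e : (R.ring ⧸ Ideal.span s) →+* R.fiberRing Γ)
  -- Only an inequality, since the images of the `aᵢ - γᵢ` in `R` are not shown to be distinct; it
  -- suffices.
  have h3 : s.encard ≤ m := by
    rw [hs, ← Set.image_univ]
    exact (Set.encard_image_le _ _).trans (by simp)
  rw [h2] at h1
  exact_mod_cast h1.trans (add_le_add_right h3 _)

end PositiveAlgebra

/-! ### Comparison of embedding dimensions and the equivalence -/

namespace PositiveAlgebra

open MvPolynomial

variable {K : Type u} [Field K] {m k : ℕ} (R : PositiveAlgebra K m k) (Γ : Fin m → K)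

/-- The linear part at the point `Γ₀` of a polynomial in `a₁, …, aₘ, x₁, …, xₖ`. -/
noncomputable def linearPartAt (k : ℕ) (Γ : Fin m → K) :
    TotalRing K m k →ₗ[K] (Fin m ⊕ Fin k → K) :=
  LinearMap.pi <| Sum.elim
    (fun i => (MvPolynomial.aeval Γ : BaseRing K m →ₐ[K] K).toLinearMap ∘ₗ
      (pderiv i : Derivation K (BaseRing K m) (BaseRing K m)).toLinearMap ∘ₗ
        (lcoeff (BaseRing K m) (0 : Fin k →₀ ℕ)).restrictScalars K)
    (fun j => (MvPolynomial.aeval Γ : BaseRing K m →ₐ[K] K).toLinearMap ∘ₗ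
      (lcoeff (BaseRing K m) (Finsupp.single j 1)).restrictScalars K)

theorem linearPartAt_inl (f : TotalRing K m k) (i : Fin m) :
    linearPartAt k Γ f (Sum.inl i) = MvPolynomial.eval Γ (pderiv i (coeff 0 f)) := rfl

theorem linearPartAt_inr (f : TotalRing K m k) (j : Fin k) :
    linearPartAt k Γ f (Sum.inr j) = MvPolynomial.eval Γ (coeff (Finsupp.single j 1) f) := rfl

theorem evalZeroPoint_apply (f : TotalRing K m k) :
    evalZeroPoint k Γ f = MvPolynomial.eval Γ (coeff 0 f) := by
  have h : evalZeroPoint k Γ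
      = (MvPolynomial.eval Γ).comp
        (MvPolynomial.constantCoeff : TotalRing K m k →+* BaseRing K m) := by
    apply MvPolynomial.ringHom_ext <;> intros <;> simp [evalZeroPoint]
  rw [h]
  rfl

theorem finrank_cotangentSpace_localRingZeroPoint_add :
    Module.finrank (IsLocalRing.ResidueField (R.localRingZeroPoint Γ))
        (IsLocalRing.CotangentSpace (R.localRingZeroPoint Γ)) +
      Module.finrank K ((R.ideal.restrictScalars K).map (linearPartAt k Γ)) = m + k := by
  let ε : TotalRing K m k →ₐ[K] K :=
    { evalZeroPoint k Γ with
      commutes' := fun c => by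
        change evalZeroPoint k Γ (algebraMap K (TotalRing K m k) c) = c
        simp [evalZeroPoint, MvPolynomial.algebraMap_eq,
          IsScalarTower.algebraMap_apply K (BaseRing K m) (TotalRing K m k)] }
  have hε (f : TotalRing K m k) : ε f = MvPolynomial.eval Γ (coeff 0 f) :=
    evalZeroPoint_apply Γ f
  have h := finrank_cotangentSpace_add_finrank_map ε
    (Sum.elim (fun i => C (X i - C (Γ i))) X) (zeroPointIdeal_eq_span Γ) (linearPartAt k Γ)
    ?_ ?_ R.proj R.proj_surjective ?_ (R.zeroPointIdealQuot Γ) rfl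
  · rw [R.ker_proj] at h
    simpa using h
  · rintro (i | j) (i' | j')
    · simp [linearPartAt_inl, pderiv_X, Pi.single_apply]
    · simp [linearPartAt_inr, coeff_C, Finsupp.single_eq_zero, eq_comm (a := (0 : Fin k →₀ ℕ))]
    · simp [linearPartAt_inl]
    · simp [linearPartAt_inr, coeff_X, Finsupp.single_left_inj]
  · intro f hf g hg
    rw [RingHom.mem_ker, hε] at hf hg
    ext (i | j)
    · rw [linearPartAt_inl]
      simp [← constantCoeff_eq] at hf hg ⊢
      simp [hf, hg]
    · rw [linearPartAt_inr, coeff_single_one_mul]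
      simp [hf, hg]
  · rw [R.ker_proj]
    exact R.ideal_le_zeroPointIdeal Γ

theorem finrank_cotangentSpace_localRingFiber_add :
    Module.finrank (IsLocalRing.ResidueField (R.localRingFiber Γ))
        (IsLocalRing.CotangentSpace (R.localRingFiber Γ)) +
      Module.finrank K (((R.fiberIdeal Γ).restrictScalars K).map (linearPart K (Fin k))) = k := by
  have h := finrank_cotangentSpace_add_finrank_map_linearPart (Ideal.Quotient.mk (R.fiberIdeal Γ))
    Ideal.Quotient.mk_surjective (by rw [Ideal.mk_ker]; exact R.fiberIdeal_le Γ)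
    (R.fiberOriginIdeal Γ) rfl
  rw [Ideal.mk_ker] at h
  simpa using h

/-- The constant coefficient in `A` of an element of `I` is zero, so all derivatives along the `aᵢ`
vanish at `Γ₀`. What remains is the linear part of the specialized polynomial, padded with zeros by
`ι`. -/
theorem finrank_map_linearPartAt :
    Module.finrank K ((R.ideal.restrictScalars K).map (linearPartAt k Γ)) =
      Module.finrank K (((R.fiberIdeal Γ).restrictScalars K).map (linearPart K (Fin k))) := by
  let ι : (Fin k → K) →ₗ[K] (Fin m ⊕ Fin k → K) :=
    LinearMap.pi <| Sum.elim (fun _ => 0) LinearMap.proj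
  have hι : Function.Injective ι := fun v w h => by
    ext j
    exact congrFun h (Sum.inr j)
  have hl {f : TotalRing K m k} (hf : f ∈ R.ideal) : linearPartAt k Γ f =
      ι (linearPart K (Fin k) (MvPolynomial.map (MvPolynomial.eval Γ) f)) := by
    have h0 : coeff 0 f = 0 := R.constantCoeff_eq_zero hf
    ext (i | j)
    · simp [linearPartAt_inl, h0, ι]
    · simp [linearPartAt_inr, linearPart_apply, ι, coeff_map]
  have : (R.ideal.restrictScalars K).map (linearPartAt k Γ) =
      (((R.fiberIdeal Γ).restrictScalars K).map (linearPart K (Fin k))).map ι := by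
    ext v
    simp only [Submodule.mem_map, Submodule.restrictScalars_mem, mem_fiberIdeal_iff]
    constructor
    · rintro ⟨f, hf, rfl⟩
      exact ⟨_, ⟨_, ⟨f, hf, rfl⟩, rfl⟩, (hl hf).symm⟩
    · rintro ⟨_, ⟨_, ⟨f, hf, rfl⟩, rfl⟩, rfl⟩
      exact ⟨f, hf, hl hf⟩
  rw [this]
  exact (Submodule.equivMapOfInjective ι hι _).finrank_eq.symm

theorem finrank_cotangentSpace_localRingZeroPoint :
    Module.finrank (IsLocalRing.ResidueField (R.localRingZeroPoint Γ))
        (IsLocalRing.CotangentSpace (R.localRingZeroPoint Γ)) =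
      Module.finrank (IsLocalRing.ResidueField (R.localRingFiber Γ))
        (IsLocalRing.CotangentSpace (R.localRingFiber Γ)) + m := by
  have h1 := R.finrank_cotangentSpace_localRingZeroPoint_add Γ
  have h2 := R.finrank_cotangentSpace_localRingFiber_add Γ
  have h3 := R.finrank_map_linearPartAt Γ
  omega

theorem isRegularLocalRing_localRingZeroPoint_iff :
    IsRegularLocalRing (R.localRingZeroPoint Γ) ↔
      IsRegularLocalRing (R.localRingFiber Γ) ∧
        ringKrullDim (R.localRingFiber Γ) + (m : WithBot ℕ∞)
          = ringKrullDim (R.localRingZeroPoint Γ) := by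
  have : IsNoetherianRing (R.localRingZeroPoint Γ) :=
    IsLocalization.isNoetherianRing (R.zeroPointIdealQuot Γ).primeCompl _ inferInstance
  have : IsNoetherianRing (R.localRingFiber Γ) :=
    IsLocalization.isNoetherianRing (R.fiberOriginIdeal Γ).primeCompl _ inferInstance
  rw [IsRegularLocalRing.iff_finrank_cotangentSpace, IsRegularLocalRing.iff_finrank_cotangentSpace,
    finrank_cotangentSpace_localRingZeroPoint]
  have h1 := R.ringKrullDim_localRingZeroPoint_le Γ
  have h2 := ringKrullDim_le_spanFinrank_maximalIdeal (R.localRingFiber Γ)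
  have hs := IsLocalRing.spanFinrank_maximalIdeal_eq_finrank_cotangentSpace (R.localRingFiber Γ)
  rw [hs] at h2
  set e := Module.finrank (IsLocalRing.ResidueField (R.localRingFiber Γ))
        (IsLocalRing.CotangentSpace (R.localRingFiber Γ))
  constructor
  · intro h
    push_cast at h
    -- Regularity at `Γ₀` turns the dimension inequality into e + m ≤ dim + m; cancelling the finite
    -- m gives the bound opposite to `h2`.
    have h3 : (e : WithBot ℕ∞) + m ≤ ringKrullDim (R.localRingFiber Γ) + m := h ▸ h1
    have h4 : (e : WithBot ℕ∞) ≤ ringKrullDim (R.localRingFiber Γ) := by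
      rwa [ENat.WithBot.add_le_add_natCast_right_iff] at h3
    have h5 := le_antisymm h4 h2
    exact ⟨h5, h5 ▸ h⟩
  · rintro ⟨h3, h4⟩
    rw [← h4, ← h3]
    push_cast
    rfl

end PositiveAlgebra

/-! ### Positively graded algebras that are regular at the origin -/

namespace MvPolynomial

theorem weightedHomogeneousComponent_rename {σ τ A : Type*} [CommRing A] (e : τ → σ) (w : σ → ℤ)
    (n : ℤ) (f : MvPolynomial τ A) :
    weightedHomogeneousComponent w n (rename e f) =
      rename e (weightedHomogeneousComponent (w ∘ e) n f) := by
  induction f using MvPolynomial.induction_on' with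
  | monomial d a =>
    have h : Finsupp.weight w (d.mapDomain e) = Finsupp.weight (w ∘ e) d := by
      simp only [Finsupp.weight_apply]
      rw [Finsupp.sum_mapDomain_index (by simp) (by intros; simp [add_mul])]
      rfl
    rw [rename_monomial,
      weightedHomogeneousComponent_of_mem (isWeightedHomogeneous_monomial w _ a h),
      weightedHomogeneousComponent_of_mem (isWeightedHomogeneous_monomial (w ∘ e) _ a rfl)]
    split_ifs
    · rw [rename_monomial]
    · rw [map_zero]
  | add p q hp hq => simp only [map_add, hp, hq]

theorem weightedHomogeneousComponent_map {σ A B : Type*} [CommRing A] [CommRing B] (g : A →+* B)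
    (w : σ → ℤ) (n : ℤ) (f : MvPolynomial σ A) :
    weightedHomogeneousComponent w n (map g f) = map g (weightedHomogeneousComponent w n f) := by
  ext d
  rw [coeff_map, coeff_weightedHomogeneousComponent, coeff_weightedHomogeneousComponent, coeff_map]
  split_ifs <;> simp

/-- Removing one factor `X t` leaves a monomial of weight zero, which is trivial because all weights
are positive. -/
theorem eq_single_of_weight_eq {σ : Type*} {w : σ → ℤ} (hw : ∀ s, 0 < w s) {d : σ →₀ ℕ} {t : σ}
    (ht : d t ≠ 0) (h : Finsupp.weight w d = w t) : d = Finsupp.single t 1 := by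
  classical
  have hle : Finsupp.single t 1 ≤ d := by
    rw [Finsupp.single_le_iff]
    exact Nat.one_le_iff_ne_zero.2 ht
  obtain ⟨e, rfl⟩ := exists_add_of_le hle
  have he : Finsupp.weight w e = 0 := by
    rw [map_add, Finsupp.weight_single, one_smul] at h
    linarith
  rw [Finsupp.weight_apply, Finsupp.sum,
    Finset.sum_eq_zero_iff_of_nonneg fun s _ => nsmul_nonneg (hw s).le _] at he
  have : e = 0 := by
    ext s
    by_contra hs
    have := he s (Finsupp.mem_support_iff.2 hs)
    simp only [nsmul_eq_mul, mul_eq_zero, Nat.cast_eq_zero] at this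
    exact this.elim hs (hw s).ne'
  rw [this, add_zero]

/-- In a minimal system of homogeneous generators of positive degree, no relation has a
linear part. -/
theorem linearPart_eq_zero_of_minimal {K τ S : Type*} [Field K] [CommRing S] [Algebra K S]
    {w : τ → ℤ} (hw : ∀ s, 0 < w s) (φ : MvPolynomial τ K →ₐ[K] S)
    (hhom : ∀ f, φ f = 0 → ∀ n, φ (weightedHomogeneousComponent w n f) = 0)
    (hmin : ∀ t, φ (X t) ∉ Algebra.adjoin K ((fun s => φ (X s)) '' {t}ᶜ))
    {f : MvPolynomial τ K} (hf : φ f = 0) : linearPart K τ f = 0 := by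
  classical
  ext t
  rw [linearPart_apply, Pi.zero_apply]
  by_contra hc
  set c := coeff (Finsupp.single t 1) f with hcdef
  -- The only monomial of weight `w t` involving `X t` is `X t` itself, so `h` is free of `X t`. As
  -- `φ` kills the component and `c ≠ 0`, the relation expresses `φ (X t)` through the other
  -- generators.
  set h := weightedHomogeneousComponent w (w t) f - C c * X t with hdef
  have hsupp : h ∈ supported K ({t}ᶜ : Set τ) := by
    rw [mem_supported]
    intro s hs
    obtain ⟨d, hd, hsd⟩ := (mem_vars_iff_mem_support s).1 hs
    rintro rfl
    rw [Finsupp.mem_support_iff] at hsd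
    rw [mem_support_iff, hdef, coeff_sub, coeff_weightedHomogeneousComponent, coeff_C_mul,
      coeff_X] at hd
    by_cases h1 : Finsupp.weight w d = w s
    · have := eq_single_of_weight_eq hw hsd h1
      subst this
      simp [hcdef, Finsupp.weight_single] at hd
    · have h2 : d ≠ Finsupp.single s 1 := by
        rintro rfl
        simp [Finsupp.weight_single] at h1
      simp [h1, h2.symm] at hd
  have h1 : φ h ∈ Algebra.adjoin K ((fun s => φ (X s)) '' {t}ᶜ) := by
    have : φ h ∈ (supported K ({t}ᶜ : Set τ)).map φ := Subalgebra.mem_map.2 ⟨h, hsupp, rfl⟩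
    rwa [supported_eq_adjoin_X, AlgHom.map_adjoin, ← Set.image_comp] at this
  have h2 : φ h = -(c • φ (X t)) := by
    rw [hdef, map_sub, hhom f hf, zero_sub, ← smul_eq_C_mul, map_smul]
  have h3 : φ (X t) = -(c⁻¹ • φ h) := by
    rw [h2, smul_neg, neg_neg, smul_smul, inv_mul_cancel₀ hc, one_smul]
  refine hmin t (h3 ▸ neg_mem (Subalgebra.smul_mem _ h1 _))

theorem exists_minimal_adjoin_eq_top {K ι S : Type*} [Field K] [CommRing S] [Algebra K S]
    [Finite ι] (x : ι → S) (hx : Algebra.adjoin K (Set.range x) = ⊤) :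
    ∃ T : Set ι, Algebra.adjoin K (x '' T) = ⊤ ∧
      ∀ t ∈ T, x t ∉ Algebra.adjoin K (x '' (T \ {t})) := by
  obtain ⟨T, hT⟩ := (Set.toFinite {T : Set ι | Algebra.adjoin K (x '' T) = ⊤}).exists_minimal
    ⟨Set.univ, by simpa using hx⟩
  refine ⟨T, hT.1, fun t ht hmem => ?_⟩
  have h1 : Algebra.adjoin K (x '' (T \ {t})) = ⊤ := by
    rw [eq_top_iff, ← hT.1, Algebra.adjoin_le_iff]
    rintro _ ⟨s, hs, rfl⟩
    by_cases hst : s = t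
    · exact hst ▸ hmem
    · exact Algebra.subset_adjoin ⟨s, ⟨hs, hst⟩, rfl⟩
  exact (hT.2 h1 Set.sdiff_subset ht).2 rfl

theorem mem_span_range_X_iff {K σ : Type*} [Field K] {f : MvPolynomial σ K} :
    f ∈ Ideal.span (Set.range (X : σ → MvPolynomial σ K)) ↔ coeff 0 f = 0 := by
  rw [ker_evalOrigin, RingHom.mem_ker, evalOrigin_apply]

/-- A positively graded algebra over a field that is regular at the origin is a polynomial ring. -/
theorem exists_algEquiv_of_isRegularLocalRing {K σ : Type*} [Field K] [Finite σ]
    {w : σ → ℤ} (hw : ∀ s, 0 < w s) (J : Ideal (MvPolynomial σ K))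
    (hJ : J ≤ Ideal.span (Set.range X))
    (hhom : ∀ f ∈ J, ∀ n, weightedHomogeneousComponent w n f ∈ J)
    (p : Ideal (MvPolynomial σ K ⧸ J)) [p.IsPrime]
    (hp : p = (Ideal.span (Set.range X)).map (Ideal.Quotient.mk J))
    [IsRegularLocalRing (Localization.AtPrime p)] :
    ∃ d : ℕ, Nonempty ((MvPolynomial σ K ⧸ J) ≃ₐ[K] MvPolynomial (Fin d) K) := by
  classical
  let π := Ideal.Quotient.mkₐ K J
  have hπ : Function.Surjective π := Ideal.Quotient.mkₐ_surjective K J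
  have hπ0 (f : MvPolynomial σ K) : π f = 0 ↔ f ∈ J := Ideal.Quotient.eq_zero_iff_mem
  obtain ⟨T, hT, hmin⟩ := exists_minimal_adjoin_eq_top (K := K) (fun s => π (X s)) (by
    rw [Algebra.adjoin_range_eq_range_aeval, AlgHom.range_eq_top]
    convert! hπ
    exact MvPolynomial.algHom_ext (by simp))
  have := Fintype.ofFinite T
  let φ : MvPolynomial T K →ₐ[K] MvPolynomial σ K ⧸ J := π.comp (rename (↑))
  have hφ : Function.Surjective φ := by
    have h1 : φ = aeval fun t : T => π (X (t : σ)) := MvPolynomial.algHom_ext (by simp [φ])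
    rw [← AlgHom.range_eq_top, h1, ← Algebra.adjoin_range_eq_range_aeval, ← hT,
      Set.image_eq_range]
  have hlin {f : MvPolynomial T K} (hf : φ f = 0) : linearPart K T f = 0 := by
    refine linearPart_eq_zero_of_minimal (w := w ∘ ((↑) : T → σ)) (fun t => hw t) φ ?_ ?_ hf
    · intro g hg n
      rw [AlgHom.comp_apply, hπ0] at hg ⊢
      rw [← weightedHomogeneousComponent_rename]
      exact hhom _ hg n
    · intro t
      have h1 : (fun s : T => φ (X s)) '' {t}ᶜ = (fun s => π (X s)) '' (T \ {(t : σ)}) := by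
        ext y
        simp only [Set.mem_image, Set.mem_compl_iff, Set.mem_singleton_iff, Set.mem_sdiff, φ,
          AlgHom.comp_apply, rename_X, Subtype.exists, Subtype.ext_iff]
        grind
      rw [h1]
      simpa [φ] using hmin t t.2
  have hcoeff (f : MvPolynomial T K) : coeff 0 (rename ((↑) : T → σ) f) = coeff 0 f := by
    simp only [← constantCoeff_eq, constantCoeff_rename]
  have hker : RingHom.ker φ.toRingHom ≤ Ideal.span (Set.range X) := by
    intro f hf
    have h1 : rename (↑) f ∈ J := (hπ0 _).1 hf
    rw [mem_span_range_X_iff, ← hcoeff]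
    exact mem_span_range_X_iff.1 (hJ h1)
  -- Discarding generators keeps the origin: each discarded `X j` is congruent modulo `J` to a
  -- polynomial in the remaining ones, without constant term because `J` lies in the ideal of the
  -- origin.
  have hpφ : p = (Ideal.span (Set.range X)).map φ.toRingHom := by
    rw [hp]
    apply le_antisymm
    · rw [Ideal.map_span, Ideal.span_le]
      rintro _ ⟨_, ⟨j, rfl⟩, rfl⟩
      obtain ⟨g, hg⟩ := hφ (π (X j))
      have h1 : rename (↑) g - X j ∈ J := by
        rw [← hπ0, map_sub, sub_eq_zero]
        exact hg
      have h2 := mem_span_range_X_iff.1 (hJ h1)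
      rw [coeff_sub, hcoeff, coeff_zero_X, sub_zero] at h2
      change π (X j) ∈ _
      rw [← hg]
      exact Ideal.mem_map_of_mem φ.toRingHom (mem_span_range_X_iff.2 h2)
    · rw [Ideal.map_span, Ideal.span_le]
      rintro _ ⟨_, ⟨j, rfl⟩, rfl⟩
      have : φ.toRingHom (X j) = Ideal.Quotient.mk J (X (j : σ)) := by
        change π (rename (↑) (X j)) = _
        rw [rename_X]
        rfl
      rw [this]
      exact Ideal.mem_map_of_mem _ (Ideal.subset_span ⟨_, rfl⟩)
  have hfin := finrank_cotangentSpace_add_finrank_map_linearPart φ.toRingHom hφ hker p hpφ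
  have hbot : ((RingHom.ker φ.toRingHom).restrictScalars K).map (linearPart K T) = ⊥ := by
    rw [eq_bot_iff]
    rintro _ ⟨f, hf, rfl⟩
    exact hlin hf
  rw [hbot, finrank_bot, add_zero] at hfin
  have hreg := (IsRegularLocalRing.iff_finrank_cotangentSpace (Localization.AtPrime p)).1 ‹_›
  rw [hfin, IsLocalization.AtPrime.ringKrullDim_eq_height p (Localization.AtPrime p)] at hreg
  have hdim : (Fintype.card T : WithBot ℕ∞) ≤ ringKrullDim (MvPolynomial σ K ⧸ J) :=
    hreg.le.trans Ideal.height_le_ringKrullDim_of_isPrime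
  have hinj : Function.Injective φ := by
    rw [injective_iff_map_eq_zero]
    intro f hf
    by_contra hf0
    -- A nonzero relation is a nonzerodivisor in the polynomial ring, so the quotient loses at least
    -- one dimension, contradicting `hdim`.
    have h1 := ringKrullDim_succ_le_of_surjective φ.toRingHom hφ
      (mem_nonZeroDivisors_of_ne_zero hf0) hf
    rw [MvPolynomial.ringKrullDim_of_isNoetherianRing, ringKrullDim_eq_zero_of_field, zero_add,
      Nat.card_eq_fintype_card] at h1
    have h2 : ((Fintype.card T + 1 : ℕ) : WithBot ℕ∞) ≤ (Fintype.card T : ℕ) := by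
      push_cast
      exact (add_le_add_left hdim 1).trans h1
    have h3 : Fintype.card T + 1 ≤ Fintype.card T := by exact_mod_cast h2
    omega
  exact ⟨Fintype.card T, ⟨(AlgEquiv.ofBijective φ ⟨hinj, hφ⟩).symm.trans
    (renameEquiv K (Fintype.equivFin T))⟩⟩

end MvPolynomial

namespace PositiveAlgebra

open MvPolynomial

variable {K : Type u} [Field K] {m k : ℕ} (R : PositiveAlgebra K m k) (Γ : Fin m → K)

/-- The fiber ideal is homogeneous: substitution affects only coefficients, which have degree zero,
and so commutes with taking homogeneous components. -/
theorem exists_fiberRing_algEquiv (h : IsRegularLocalRing (R.localRingFiber Γ)) :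
    ∃ d : ℕ, Nonempty (R.fiberRing Γ ≃ₐ[K] MvPolynomial (Fin d) K) := by
  refine exists_algEquiv_of_isRegularLocalRing R.weight_pos (R.fiberIdeal Γ) (R.fiberIdeal_le Γ)
    ?_ (R.fiberOriginIdeal Γ) rfl
  intro g hg n
  rw [mem_fiberIdeal_iff] at hg ⊢
  obtain ⟨f, hf, rfl⟩ := hg
  exact ⟨_, weightedHomogeneousComponent_mem_of_mem _ _ R.isHomogeneous hf n,
    (weightedHomogeneousComponent_map _ _ _ _).symm⟩

end PositiveAlgebra

/-! ### The scheme-theoretic fiber -/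

namespace PositiveAlgebra

open MvPolynomial

variable {K : Type u} [Field K] {m k : ℕ} (R : PositiveAlgebra K m k) (Γ : Fin m → K)

theorem toFiberRing_proj_C (a : BaseRing K m) : R.toFiberRing Γ (R.proj (C a)) =
    algebraMap K (R.fiberRing Γ) (MvPolynomial.eval Γ a) := by
  rw [toFiberRing_proj, map_C]
  rfl

/-- The kernel of `R.toFiberRing Γ` is generated by the `aᵢ - γᵢ`, which any map compatible with
evaluation at `Γ` kills; surjectivity gives uniqueness. -/
theorem isPushout_fiberRing :
    IsPushout (CommRingCat.ofHom (R.proj.comp C)) (CommRingCat.ofHom (MvPolynomial.eval Γ))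
      (CommRingCat.ofHom (R.toFiberRing Γ))
      (CommRingCat.ofHom (algebraMap K (R.fiberRing Γ))) := by
  have hdesc (s : Limits.PushoutCocone (CommRingCat.ofHom (R.proj.comp C))
      (CommRingCat.ofHom (MvPolynomial.eval Γ))) :
      ∃ d : R.fiberRing Γ →+* s.pt, ∀ y, d (R.toFiberRing Γ y) = s.inl.hom y := by
    have hker : RingHom.ker (R.toFiberRing Γ) ≤ RingHom.ker s.inl.hom := by
      rw [ker_toFiberRing, Ideal.span_le]
      rintro _ ⟨i, rfl⟩
      have h1 : s.inl.hom (R.proj (C (X i - C (Γ i)))) =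
          s.inr.hom (MvPolynomial.eval Γ (X i - C (Γ i))) :=
        ConcreteCategory.congr_hom s.condition (X i - C (Γ i))
      rw [SetLike.mem_coe, RingHom.mem_ker, h1]
      simp
    exact ⟨(R.toFiberRing Γ).liftOfRightInverse _
      (Function.rightInverse_surjInv (R.toFiberRing_surjective Γ)) ⟨s.inl.hom, hker⟩,
      fun y => RingHom.liftOfRightInverse_comp_apply _ _ _ _ y⟩
  choose d hd using hdesc
  refine ⟨⟨?_⟩, ⟨Limits.PushoutCocone.IsColimit.mk _ (fun s => CommRingCat.ofHom (d s))
    (fun s => ?_) (fun s => ?_) (fun s g hg _ => ?_)⟩⟩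
  · exact CommRingCat.hom_ext (RingHom.ext fun a => R.toFiberRing_proj_C Γ a)
  · exact CommRingCat.hom_ext (RingHom.ext fun y => hd s y)
  · refine CommRingCat.hom_ext (RingHom.ext fun c => ?_)
    have h1 : algebraMap K (R.fiberRing Γ) c = R.toFiberRing Γ (R.proj (C (C c))) := by
      rw [toFiberRing_proj_C, eval_C]
    have h2 : s.inl.hom (R.proj (C (C c))) = s.inr.hom (MvPolynomial.eval Γ (C c)) :=
      ConcreteCategory.congr_hom s.condition (C c)
    rw [eval_C] at h2
    change d s (algebraMap K (R.fiberRing Γ) c) = s.inr.hom c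
    rw [h1, hd, h2]
  · refine CommRingCat.hom_ext (RingHom.ext fun y => ?_)
    obtain ⟨z, rfl⟩ := R.toFiberRing_surjective Γ y
    exact (ConcreteCategory.congr_hom hg z).trans (hd s z).symm

/-- The residue field of the base point over `Γ` is `K`. -/
theorem exists_iso_residueField : ∃ e : CommRingCat.of K ≅
    (Spec (CommRingCat.of (BaseRing K m))).residueField (basePoint Γ),
    Spec.map e.hom ≫ Spec.map (CommRingCat.ofHom (MvPolynomial.eval Γ)) =
      (Spec (CommRingCat.of (BaseRing K m))).fromSpecResidueField (basePoint Γ) := by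
  let p : Ideal (BaseRing K m) := (basePoint Γ).asIdeal
  have hpdef : p = RingHom.ker (MvPolynomial.eval Γ) := rfl
  have hpm : p.IsMaximal := RingHom.ker_isMaximal_of_surjective _ (eval_surjective Γ)
  let h : K →+* p.ResidueField := (algebraMap (BaseRing K m) p.ResidueField).comp C
  have hh (a : BaseRing K m) : h (MvPolynomial.eval Γ a) =
      algebraMap (BaseRing K m) p.ResidueField a := by
    rw [RingHom.comp_apply, ← sub_eq_zero, ← map_sub, Ideal.algebraMap_residueField_eq_zero,
      hpdef, RingHom.mem_ker]
    simp
  have hbij : Function.Bijective h := by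
    refine ⟨h.injective, fun y => ?_⟩
    obtain ⟨a, rfl⟩ := p.algebraMap_residueField_surjective y
    exact ⟨_, hh a⟩
  refine ⟨(RingEquiv.ofBijective h hbij).toCommRingCatIso ≪≫
    (Scheme.Spec.residueFieldIso (CommRingCat.of (BaseRing K m)) (basePoint Γ)).symm, ?_⟩
  rw [← Scheme.Spec.map_residueFieldIso_inv_eq_fromSpecResidueField, Iso.trans_hom, Spec.map_comp,
    Category.assoc, ← Spec.map_comp]
  congr 2
  exact CommRingCat.hom_ext (RingHom.ext hh)

theorem nonempty_fiber_iso :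
    Nonempty (R.fiber Γ ≅
      Over.mk (Spec.map (CommRingCat.ofHom (algebraMap K (R.fiberRing Γ))))) := by
  obtain ⟨e, he⟩ := exists_iso_residueField Γ
  have h1 := isPullback_SpecMap_of_isPushout _ _ _ _ (R.isPushout_fiberRing Γ)
  -- The defining square of the fiber, with the spectrum of the residue field replaced by that of
  -- `K` through `e`.
  have h2 : IsPullback (R.canonicalMorphism.fiberι (basePoint Γ))
      (R.canonicalMorphism.fiberToSpecResidueField (basePoint Γ) ≫ Spec.map e.hom)
      (Spec.map (CommRingCat.ofHom (R.proj.comp C)))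
      (Spec.map (CommRingCat.ofHom (MvPolynomial.eval Γ))) :=
    (IsPullback.of_hasPullback R.canonicalMorphism
      ((Spec (CommRingCat.of (BaseRing K m))).fromSpecResidueField (basePoint Γ))).of_iso
      (Iso.refl _) (Iso.refl _) (Scheme.Spec.mapIso e.op) (Iso.refl _)
      ((Category.comp_id _).trans (Category.id_comp _).symm) ((Category.id_comp _).symm)
      ((Category.comp_id _).trans (Category.id_comp _).symm)
      ((Category.comp_id _).trans he.symm)
  refine ⟨Over.isoMk (h2.isoIsPullback _ _ h1) ?_⟩
  -- The `K`-structure on the fiber is defined through `Spec R`, so the structure map of the fiber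
  -- ring must be factored through `R`.
  have h3 : CommRingCat.ofHom (algebraMap K (R.fiberRing Γ)) =
      CommRingCat.ofHom (R.proj.comp (C.comp C)) ≫ CommRingCat.ofHom (R.toFiberRing Γ) := by
    ext c
    change _ = R.toFiberRing Γ (R.proj (C (C c)))
    rw [toFiberRing_proj_C, eval_C]
    rfl
  have h4 := congrArg Spec.map h3
  rw [Spec.map_comp] at h4
  have h5 := h2.isoIsPullback_hom_fst _ _ h1
  refine (congrArg (fun f => (h2.isoIsPullback _ _ h1).hom ≫ f) h4).trans ?_
  refine (Category.assoc _ _ _).symm.trans ?_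
  exact congrArg (fun f => f ≫ Spec.map (CommRingCat.ofHom (R.proj.comp (C.comp C)))) h5

theorem exists_fiber_iso_affineSpaceOver (h : IsRegularLocalRing (R.localRingFiber Γ)) :
    ∃ d : ℕ, Nonempty (R.fiber Γ ≅ affineSpaceOver K d) := by
  obtain ⟨d, ⟨e⟩⟩ := R.exists_fiberRing_algEquiv Γ h
  obtain ⟨i⟩ := R.nonempty_fiber_iso Γ
  refine ⟨d, ⟨i ≪≫ Over.isoMk (Scheme.Spec.mapIso
    e.symm.toRingEquiv.toCommRingCatIso.op) ?_⟩⟩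
  change Spec.map _ ≫ Spec.map _ = Spec.map _
  rw [← Spec.map_comp]
  congr 1
  ext c
  exact e.symm.commutes c

end PositiveAlgebra

theorem mainTheorem5 {K : Type u} [Field K] {m k : ℕ} (R : PositiveAlgebra K m k)
    (Γ : Fin m → K) :
    (IsRegularLocalRing (R.localRingZeroPoint Γ) ↔
      IsRegularLocalRing (R.localRingFiber Γ) ∧
        ringKrullDim (R.localRingFiber Γ) + (m : WithBot ℕ∞)
          = ringKrullDim (R.localRingZeroPoint Γ)) ∧
    (IsRegularLocalRing (R.localRingFiber Γ) →
      ∃ d : ℕ, Nonempty (R.fiber Γ ≅ PositiveAlgebra.affineSpaceOver K d)) :=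
  ⟨R.isRegularLocalRing_localRingZeroPoint_iff Γ, R.exists_fiber_iso_affineSpaceOver Γ⟩
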